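/- Work in continuous first-order logic, with all continuous functions $\mathbb{R}^m\to\mathbb{R}$ as connectives. Let $L_N$ be the language of real Hilbert spaces (many-sorted, with the closed balls of radius $1,2,3,\dots$ around $0$ as sorts) together with a unary $1$-Lipschitz predicate $d_N$ with values in $[0,1]$. Let $T_0$ be the theory of Hilbert spaces together with the axioms $$\sup_x\min\Big\{1\mathbin{\dot-}d_N(x),\ \inf_y\max\{|d_N(x)-\|x-y\||,\,d_N(y)\}\Big\}=0,\qquad \sup_x\sup_y\,[d_N(y)-\|x-y\|-d_N(x)]\le 0,$$ which say that $d_N$ is the distance to a set, truncated at $1$. Let $T_N$ be the model companion of $T_0\cup\{d_N(0)=0\}$, that is, the common theory of the existentially closed models of $T_0\cup\{d_N(0)=0\}$. A theory $T$ has $TP_2$ if there are a formula $\varphi(\bar x;\bar y)$, an integer $k$, a model $M\models T$ and an array $(\bar a_{i,j})_{i,j<\omega}$ of parameters in $M$ (in the sorts of $\bar y$) such that for each $i$ the set $\{\varphi(\bar x;\bar a_{i,j})=0 : j<\omega\}$ is $k$-inconsistent (no $k$ of these conditions are jointly realized in an elementary extension of $M$), while for each $f:\omega\to\omega$ the set $\{\varphi(\bar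 x;\bar a_{i,f(i)})=0 : i<\omega\}$ is consistent (realized in an elementary extension of $M$). **Theorem.** The theory $T_N$ has the tree property $TP_2$. Moreover, there are a model $U\models T_N$ and an orthonormal family $\{a_f : f\in\omega^\omega\}\cup\{b_n : n<\omega\}\cup\{c_{n,i} : n,i<\omega\}$ in $U$ such that, with $$N=\{a_f+b_n+\tfrac12 c_{n,f(n)} : n<\omega,\ f\in\omega^\omega\}\cup\{0\},$$ one has $d_N(x)=\min\{1,\operatorname{dist}(x,N)\}$ for all $x$ in the closed linear span of the family, and the formula $$\varphi(x;y,z)=\max\{1-d_N(x+y-\tfrac12 z),\ d_N(x+y+\tfrac12 z)\},$$ with $x,y,z$ in the sort of radius $1$, together with the array $(b_i,c_{i,j})_{i,j<\omega}$ witnesses $TP_2$: its rows are $2$-inconsistent and its paths are consistent. -/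

import Mathlib

universe u

namespace HilbertBlack

/-! ## Structures -/

/-- A structure in the language `L_N`: a real Hilbert space `H` (regarded as the many-sorted metric
structure whose sorts are the closed balls of radius `1, 2, 3, …` around `0`) with a unary predicate
`d_N : H → [0, 1]`, whose modulus of uniform continuity is the identity. -/
structure LNStructure : Type (u + 1) where
  carrier : Type u
  [normed : NormedAddCommGroup carrier]
  [innerProduct : InnerProductSpace ℝ carrier]
  [complete : CompleteSpace carrier]
  dN : carrier → ℝ
  dN_nonneg : ∀ x, 0 ≤ dN x
  dN_le_one : ∀ x, dN x ≤ 1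
  dN_modulus : ∀ x y, |dN x - dN y| ≤ ‖x - y‖

instance : CoeSort LNStructure.{u} (Type u) := ⟨LNStructure.carrier⟩

attribute [instance] LNStructure.normed LNStructure.innerProduct LNStructure.complete

/-- An embedding of `L_N`-structures; through it `N` is an extension of `M`. -/
structure LNEmbedding (M N : LNStructure.{u}) where
  toMap : M →ₗᵢ[ℝ] N
  map_dN : ∀ x, N.dN (toMap x) = M.dN x

/-! ## Continuous first-order logic in the language `L_N` -/

/-- Terms in the variables `0, …, n - 1`. -/
inductive Term (n : ℕ) : Type
  | var : Fin n → Term n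
  | zero : Term n
  | add : Term n → Term n → Term n
  | smul : ℝ → Term n → Term n

/-- Formulas in the free variables `0, …, n - 1`. The connectives are the continuous functions
`ℝᵐ → ℝ`. The quantifiers `sup R φ`, `inf R φ` range over the sort of radius `R` and bind the
variable `0` of `φ`; the variable `i + 1` of `φ` is the variable `i` of the quantified formula. -/
inductive Formula : ℕ → Type
  | dist {n : ℕ} : Term n → Term n → Formula n
  | inner {n : ℕ} : Term n → Term n → Formula n
  | dN {n : ℕ} : Term n → Formula n
  | conn {n m : ℕ} : C(Fin m → ℝ, ℝ) → (Fin m → Formula n) → Formula n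
  | sup {n : ℕ} : ℕ+ → Formula (n + 1) → Formula n
  | inf {n : ℕ} : ℕ+ → Formula (n + 1) → Formula n

/-- The value of a term. -/
def Term.eval (M : LNStructure.{u}) {n : ℕ} (v : Fin n → M) : Term n → M
  | .var i => v i
  | .zero => 0
  | .add s t => s.eval M v + t.eval M v
  | .smul r t => r • t.eval M v

/-- The value of a formula. On tuples of bounded norm every formula is bounded, so that the suprema
and infima are taken over bounded nonempty sets of reals. -/
noncomputable def Formula.eval (M : LNStructure.{u}) : {n : ℕ} → Formula n → (Fin n → M) → ℝ
  | _, .dist s t, v => ‖s.eval M v - t.eval M v‖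
  | _, .inner s t, v => Inner.inner ℝ (s.eval M v) (t.eval M v)
  | _, .dN t, v => M.dN (t.eval M v)
  | _, .conn w φ, v => w fun i => (φ i).eval M v
  | _, .sup R φ, v => ⨆ x : Metric.closedBall (0 : M) (R : ℕ), φ.eval M (Fin.cons x.1 v)
  | _, .inf R φ, v => ⨅ x : Metric.closedBall (0 : M) (R : ℕ), φ.eval M (Fin.cons x.1 v)

/-- Quantifier-free formulas. -/
def Formula.IsQF : {n : ℕ} → Formula n → Prop
  | _, .dist _ _ => True
  | _, .inner _ _ => True
  | _, .dN _ => True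
  | _, .conn _ φ => ∀ i, (φ i).IsQF
  | _, .sup _ _ => False
  | _, .inf _ _ => False

/-- A theory is a set of sentences `σ`, standing for the closed conditions `σ = 0`. -/
abbrev Theory : Type := Set (Formula 0)

/-- `M` is a model of `T`. -/
def Models (M : LNStructure.{u}) (T : Theory) : Prop :=
  ∀ σ ∈ T, σ.eval M Fin.elim0 = 0

/-- An embedding is elementary if it preserves the values of all formulas. -/
def LNEmbedding.IsElementary {M N : LNStructure.{u}} (e : LNEmbedding M N) : Prop :=
  ∀ (n : ℕ) (φ : Formula n) (v : Fin n → M), φ.eval N (fun i => e.toMap (v i)) = φ.eval M v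

/-- `M` is an existentially closed model of `T`: whenever a tuple `b` in a model `N ⊇ M` of `T`,
taken from sorts with radii `r`, satisfies a condition `ψ(b, v) = 0` with `ψ` quantifier-free and
`v` in `M`, then `inf_x |ψ(x, v)| = 0` in `M`, where `x` ranges over the same sorts. -/
def IsExistentiallyClosed (T : Theory) (M : LNStructure.{u}) : Prop :=
  Models M T ∧
    ∀ (N : LNStructure.{u}) (e : LNEmbedding M N), Models N T →
      ∀ (p q : ℕ) (ψ : Formula (p + q)), ψ.IsQF →
        ∀ (r : Fin p → ℕ+) (b : Fin p → N) (v : Fin q → M), (∀ l, ‖b l‖ ≤ (r l : ℕ)) →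
          ψ.eval N (Fin.append b fun i => e.toMap (v i)) = 0 →
            ∀ ε : ℝ, 0 < ε → ∃ a : Fin p → M, (∀ l, ‖a l‖ ≤ (r l : ℕ)) ∧
              |ψ.eval M (Fin.append a v)| < ε

/-! ## The theories `T_0` and `T_N` -/

/-- `sup_x min {1 ∸ d_N(x), inf_y max {|d_N(x) - ‖x - y‖|, d_N(y)}}`, with `x` in the sort of radius
`R` and `y` in the sort of radius `R + 1`. -/
def witnessAxiom (R : ℕ+) : Formula 0 :=
  .sup R
    (.conn (m := 2) ⟨fun w => min (max (1 - w 0) 0) (w 1), by fun_prop⟩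
      ![.dN (.var 0),
        .inf (R + 1)
          (.conn (m := 3) ⟨fun w => max |w 0 - w 1| (w 2), by fun_prop⟩
            ![.dN (.var 1), .dist (.var 1) (.var 0), .dN (.var 0)])])

/-- `sup_x sup_y max {d_N(y) - ‖x - y‖ - d_N(x), 0}`, with `x` and `y` in the sort of
radius `R`. -/
def lipschitzAxiom (R : ℕ+) : Formula 0 :=
  .sup R
    (.sup R
      (.conn (m := 3) ⟨fun w => max (w 0 - w 1 - w 2) 0, by fun_prop⟩
        ![.dN (.var 0), .dist (.var 1) (.var 0), .dN (.var 1)]))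

/-- `T_0`: the theory of Hilbert spaces with a distance to a set, truncated at `1`. -/
def T0 : Theory := Set.range witnessAxiom ∪ Set.range lipschitzAxiom

/-- `T_0` together with the axiom `d_N(0) = 0`. -/
def T0black : Theory := T0 ∪ {.dN .zero}

/-- `T_N`, the model companion of `T_0 ∪ {d_N(0) = 0}`: the common theory of the existentially
closed models of `T_0 ∪ {d_N(0) = 0}`. -/
def TN : Theory :=
  {σ | ∀ M : LNStructure.{u}, IsExistentiallyClosed T0black M → σ.eval M Fin.elim0 = 0}

/-! ## The tree property `TP_2` -/

/-- The set of conditions `φ(x, b) = 0`, `b ∈ A`, with parameters in `M` and with `x` ranging over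
the sorts of radii `r`, is consistent: it is realized in some elementary extension of `M`. -/
def Consistent (M : LNStructure.{u}) {p q : ℕ} (φ : Formula (p + q)) (r : Fin p → ℕ+)
    (A : Set (Fin q → M)) : Prop :=
  ∃ (N : LNStructure.{u}) (e : LNEmbedding M N), e.IsElementary ∧
    ∃ x : Fin p → N, (∀ l, ‖x l‖ ≤ (r l : ℕ)) ∧
      ∀ b ∈ A, φ.eval N (Fin.append x fun i => e.toMap (b i)) = 0

/-- The array `a` of parameters (from the sorts of radii `ρ`) shows that `φ(x; y)` has `TP_2`:
all rows are `k`-inconsistent and all paths are consistent. -/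
def IsTP2Array (M : LNStructure.{u}) {p q : ℕ} (φ : Formula (p + q)) (r : Fin p → ℕ+)
    (ρ : Fin q → ℕ+) (k : ℕ) (a : ℕ → ℕ → Fin q → M) : Prop :=
  (∀ i j l, ‖a i j l‖ ≤ (ρ l : ℕ)) ∧
  (∀ (i : ℕ) (s : Finset ℕ), s.card = k → ¬ Consistent M φ r (a i '' (s : Set ℕ))) ∧
  ∀ f : ℕ → ℕ, Consistent M φ r (Set.range fun i => a i (f i))

/-- The theory `T` has the tree property `TP_2`. -/
def HasTP2 (T : Theory) : Prop :=
  ∃ (p q : ℕ) (φ : Formula (p + q)) (r : Fin p → ℕ+) (ρ : Fin q → ℕ+) (k : ℕ)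
    (M : LNStructure.{u}) (a : ℕ → ℕ → Fin q → M), Models M T ∧ IsTP2Array M φ r ρ k a

/-! ## The formula and the configuration -/

/-- `φ(x; y, z) = max {1 - d_N(x + y - z/2), d_N(x + y + z/2)}`. -/
noncomputable def tp2Formula : Formula (1 + 2) :=
  .conn (m := 2) ⟨fun w => max (1 - w 0) (w 1), by fun_prop⟩
    ![.dN (.add (.add (.var 0) (.var 1)) (.smul (-(1 / 2)) (.var 2))),
      .dN (.add (.add (.var 0) (.var 1)) (.smul (1 / 2) (.var 2)))]

/-- Names `a_f`, `b_n`, `c_{n,i}` of the vectors of an orthonormal family. -/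
inductive Idx : Type
  | a : (ℕ → ℕ) → Idx
  | b : ℕ → Idx
  | c : ℕ → ℕ → Idx

/-- The set `{a_f + b_n + (1/2) c_{n,f(n)} | n, f} ∪ {0}`. -/
def blackSet {H : Type u} [NormedAddCommGroup H] [InnerProductSpace ℝ H] (s : Idx → H) : Set H :=
  {x | ∃ (f : ℕ → ℕ) (n : ℕ), x = s (.a f) + s (.b n) + (1 / 2 : ℝ) • s (.c n (f n))} ∪ {0}

end HilbertBlack

namespace HilbertBlack

open Filter Topology

/-! ## Models of `T_0 ∪ {d_N(0) = 0}` as Hilbert spaces with a distinguished set -/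

/-! Distances to a set in a Hilbert space give models of `T0black` (`models_ofSet`), so an
orthonormal family with its black set is one. It embeds in an existentially closed model `U`, hence
a model of `TN`, and the embedding preserves `dN`, so the predicate is known on the closed span.
Paths: a_f realizes the path f, since a_f + b_i + c/2 is black, while a_f + b_i - c/2 has distance
at least 1 from every black point (`one_le_norm_sub_of_mem_blackSet`). Rows: a common solution for j
≠ k would give two points at distance ‖c_{i,j} + c_{i,k}‖/2 = 1/√2 < 1 with values 0 and 1, against
the Lipschitz bound (`not_consistent_tp2Formula`). The main work is `exists_isExistentiallyClosed`.
Extensions of a model amalgamate orthogonally over it, the black set being the union; by Pythagoras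
no new point comes too close (`dN_le_norm_amalgamMap_sub`). Hence one extension realizes all
realizable quantifier-free conditions. Iterating ω times and completing gives `U`; uniform
continuity of quantifier-free formulas on bounded sets handles parameters that appear only in the
completion. -/

theorem LNStructure.continuous_dN (M : LNStructure.{u}) : Continuous M.dN :=
  (LipschitzWith.of_dist_le_mul (K := 1) fun x y => by
    simpa [Real.dist_eq, dist_eq_norm] using M.dN_modulus x y).continuous

theorem LNStructure.dN_le_add (M : LNStructure.{u}) (x y : M) : M.dN x ≤ M.dN y + ‖x - y‖ := by
  linarith [le_abs_self (M.dN x - M.dN y), M.dN_modulus x y]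

/-- The Hilbert space `H` with the truncated distance to the nonempty set `B`. -/
noncomputable def LNStructure.ofSet (H : Type u) [NormedAddCommGroup H] [InnerProductSpace ℝ H]
    [CompleteSpace H] (B : Set H) : LNStructure.{u} where
  carrier := H
  dN x := min 1 (Metric.infDist x B)
  dN_nonneg x := le_min zero_le_one Metric.infDist_nonneg
  dN_le_one x := min_le_left _ _
  dN_modulus x y := by
    have h := (Metric.lipschitz_infDist_pt B).dist_le_mul x y
    rw [Real.dist_eq, dist_eq_norm, NNReal.coe_one, one_mul] at h
    refine le_trans ?_ h
    simpa [abs_sub_comm] using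
      abs_min_sub_min_le_max 1 (Metric.infDist x B) 1 (Metric.infDist y B)

theorem witnessAxiom_eval_of_forall (M : LNStructure.{u}) (R : ℕ+)
    (h : ∀ x : M, ‖x‖ ≤ (R : ℕ) → M.dN x < 1 → ∀ ε : ℝ, 0 < ε →
      ∃ y : M, ‖y‖ ≤ ((R + 1 : ℕ+) : ℕ) ∧ |M.dN x - ‖x - y‖| ≤ ε ∧ M.dN y ≤ ε) :
    (witnessAxiom R).eval M Fin.elim0 = 0 := by
  have : Nonempty (Metric.closedBall (0 : M) ((R : ℕ) : ℝ)) := ⟨⟨0, by simp⟩⟩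
  have hne : Nonempty (Metric.closedBall (0 : M) (((R + 1 : ℕ+) : ℕ) : ℝ)) :=
    ⟨⟨0, Metric.mem_closedBall_self (Nat.cast_nonneg _)⟩⟩
  refine (iSup_congr fun x => ?_).trans (ciSup_const (a := (0 : ℝ)))
  have hx : ‖x.1‖ ≤ (R : ℕ) := mem_closedBall_zero_iff.1 x.2
  change min (max (1 - M.dN x.1) 0) (⨅ y : Metric.closedBall (0 : M) (((R + 1 : ℕ+) : ℕ) : ℝ),
    max |M.dN x.1 - ‖x.1 - y.1‖| (M.dN y.1)) = 0
  have hnn : 0 ≤ ⨅ y : Metric.closedBall (0 : M) (((R + 1 : ℕ+) : ℕ) : ℝ),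
      max |M.dN x.1 - ‖x.1 - y.1‖| (M.dN y.1) :=
    le_ciInf fun y => le_max_of_le_right (M.dN_nonneg _)
  rcases (M.dN_le_one x.1).lt_or_eq with hlt | heq
  · have h0 : (⨅ y : Metric.closedBall (0 : M) (((R + 1 : ℕ+) : ℕ) : ℝ),
        max |M.dN x.1 - ‖x.1 - y.1‖| (M.dN y.1)) = 0 := by
      refine le_antisymm (le_of_forall_pos_le_add fun ε hε => ?_) hnn
      obtain ⟨y, hy, h1, h2⟩ := h x.1 hx hlt ε hε
      rw [zero_add]
      exact (ciInf_le ⟨0, by rintro _ ⟨z, rfl⟩; exact le_max_of_le_right (M.dN_nonneg _)⟩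
        (⟨y, by simpa using hy⟩ : Metric.closedBall (0 : M) (((R + 1 : ℕ+) : ℕ) : ℝ))).trans
        (max_le h1 h2)
    rw [h0]
    exact min_eq_right (le_max_right _ _)
  · refine (congrArg (min · _) ?_).trans (min_eq_left hnn)
    rw [heq, sub_self, max_self]

theorem exists_of_witnessAxiom_eval (M : LNStructure.{u}) (R : ℕ+)
    (h : (witnessAxiom R).eval M Fin.elim0 = 0) {x : M} (hxR : ‖x‖ ≤ (R : ℕ))
    (hx : M.dN x < 1) {ε : ℝ} (hε : 0 < ε) :
    ∃ y : M, |M.dN x - ‖x - y‖| < ε ∧ M.dN y < ε := by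
  have hne : Nonempty (Metric.closedBall (0 : M) (((R + 1 : ℕ+) : ℕ) : ℝ)) :=
    ⟨⟨0, Metric.mem_closedBall_self (Nat.cast_nonneg _)⟩⟩
  have hle : min (max (1 - M.dN x) 0) (⨅ y : Metric.closedBall (0 : M) (((R + 1 : ℕ+) : ℕ) : ℝ),
      max |M.dN x - ‖x - y.1‖| (M.dN y.1)) ≤ (witnessAxiom R).eval M Fin.elim0 := by
    refine le_ciSup (f := fun x : Metric.closedBall (0 : M) ((R : ℕ) : ℝ) =>
      min (max (1 - M.dN x.1) 0) (⨅ y : Metric.closedBall (0 : M) (((R + 1 : ℕ+) : ℕ) : ℝ),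
        max |M.dN x.1 - ‖x.1 - y.1‖| (M.dN y.1))) ⟨1, ?_⟩ ⟨x, by simpa using hxR⟩
    rintro _ ⟨z, rfl⟩
    exact min_le_of_left_le (max_le (by linarith [M.dN_nonneg z.1]) zero_le_one)
  rw [h] at hle
  have hpos : 0 < max (1 - M.dN x) 0 := lt_max_of_lt_left (by linarith)
  have hinf : (⨅ y : Metric.closedBall (0 : M) (((R + 1 : ℕ+) : ℕ) : ℝ),
      max |M.dN x - ‖x - y.1‖| (M.dN y.1)) ≤ 0 := by
    rcases min_le_iff.1 hle with h1 | h1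
    · exact absurd h1 (not_le.2 hpos)
    · exact h1
  obtain ⟨y, hy⟩ := exists_lt_of_ciInf_lt (hinf.trans_lt hε)
  exact ⟨y.1, (le_max_left _ _).trans_lt hy, (le_max_right _ _).trans_lt hy⟩

/-- The modulus built into `LNStructure` already gives this axiom. -/
theorem lipschitzAxiom_eval (M : LNStructure.{u}) (R : ℕ+) :
    (lipschitzAxiom R).eval M Fin.elim0 = 0 := by
  have : Nonempty (Metric.closedBall (0 : M) ((R : ℕ) : ℝ)) := ⟨⟨0, by simp⟩⟩
  refine (iSup_congr fun x => ?_).trans (ciSup_const (a := (0 : ℝ)))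
  refine (iSup_congr fun y => ?_).trans (ciSup_const (a := (0 : ℝ)))
  change max (M.dN y.1 - ‖x.1 - y.1‖ - M.dN x.1) 0 = 0
  have := M.dN_le_add y.1 x.1
  rw [norm_sub_rev] at this
  exact max_eq_right (by linarith)

theorem models_ofSet {H : Type u} [NormedAddCommGroup H] [InnerProductSpace ℝ H]
    [CompleteSpace H] {B : Set H} (hB : (0 : H) ∈ B) :
    Models (LNStructure.ofSet H B) T0black := by
  rintro σ ((⟨R, rfl⟩ | ⟨R, rfl⟩) | rfl)
  · refine witnessAxiom_eval_of_forall _ _ fun x hx hlt ε hε => ?_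
    change H at x
    change min 1 (Metric.infDist x B) < 1 at hlt
    have hd : Metric.infDist x B < 1 := by
      rcases min_lt_iff.1 hlt with h | h
      · exact absurd h (lt_irrefl _)
      · exact h
    -- The bound 1 keeps `y` in the sort of radius R + 1; the other bound gives the precision ε.
    obtain ⟨y, hy, hxy⟩ := (Metric.infDist_lt_iff ⟨0, hB⟩).1
      (lt_min hd (lt_add_of_pos_right (Metric.infDist x B) hε))
    rw [dist_eq_norm] at hxy
    refine ⟨y, ?_, ?_, ?_⟩
    · have h1 : ‖x - y‖ < 1 := hxy.trans_le (min_le_left _ _)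
      have h2 : ‖y‖ ≤ ‖x‖ + ‖x - y‖ := by
        have := norm_sub_le x (x - y)
        rwa [sub_sub_cancel] at this
      change ‖x‖ ≤ _ at hx
      change ‖y‖ ≤ _
      push_cast
      linarith
    · change |min 1 (Metric.infDist x B) - ‖x - y‖| ≤ ε
      rw [min_eq_right hd.le]
      have h1 := Metric.infDist_le_dist_of_mem (x := x) hy
      rw [dist_eq_norm] at h1
      rw [abs_le]
      constructor <;> linarith [hxy.trans_le (min_le_right _ _)]
    · change min 1 (Metric.infDist y B) ≤ ε
      rw [Metric.infDist_zero_of_mem hy]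
      exact (min_le_right _ _).trans hε.le
  · exact lipschitzAxiom_eval _ _
  · change min 1 (Metric.infDist (0 : H) B) = 0
    rw [Metric.infDist_zero_of_mem hB]
    exact min_eq_right zero_le_one

theorem dN_zero_of_models {M : LNStructure.{u}} (hM : Models M T0black) : M.dN 0 = 0 :=
  hM _ (Or.inr rfl)

/-- The axiom only yields points where `dN` is small. Iterating it with geometrically decreasing
errors gives a Cauchy sequence whose limit is an exact zero. -/
theorem exists_dN_eq_zero_of_models {M : LNStructure.{u}} (hM : Models M T0black) {x : M}
    (hx : M.dN x < 1) {ε : ℝ} (hε : 0 < ε) : ∃ y : M, M.dN y = 0 ∧ ‖x - y‖ < M.dN x + ε := by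
  have hstep : ∀ (δ : ℝ) (y : M), ∃ z : M, 0 < δ → M.dN y < 1 →
      ‖y - z‖ < M.dN y + δ ∧ M.dN z < δ := by
    intro δ y
    by_cases h : 0 < δ ∧ M.dN y < 1
    · obtain ⟨n, hn⟩ := exists_nat_ge ‖y‖
      obtain ⟨z, h1, h2⟩ := exists_of_witnessAxiom_eval M n.succPNat
        (hM _ (Or.inl (Or.inl ⟨_, rfl⟩))) (x := y)
        (hn.trans (by rw [Nat.succPNat_coe]; exact_mod_cast Nat.le_succ n)) h.2 h.1
      exact ⟨z, fun _ _ => ⟨by linarith [(abs_lt.1 h1).1], h2⟩⟩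
    · exact ⟨y, fun h1 h2 => absurd ⟨h1, h2⟩ h⟩
  choose g hg using hstep
  -- The first step costs η and the remaining path at most 4η, so 5η < ε suffices; η < 1 keeps every
  -- iterate in the range where the axiom applies.
  set η : ℝ := min ε 1 / 8 with hη
  have hη0 : 0 < η := div_pos (lt_min hε one_pos) (by norm_num)
  have hη1 : η < 1 := by
    have := min_le_right ε 1
    rw [hη]; linarith
  have hηε : 5 * η < ε := by
    have := min_le_left ε 1
    rw [hη]; linarith
  let f : ℕ → M := fun n => Nat.rec (g η x) (fun k y => g (η / 2 ^ (k + 1)) y) n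
  have hδ : ∀ k : ℕ, 0 < η / 2 ^ k := fun k => by positivity
  have hδ1 : ∀ k : ℕ, η / 2 ^ k ≤ η := fun k =>
    div_le_self hη0.le (one_le_pow₀ (by norm_num))
  have hf : ∀ n, M.dN (f n) < η / 2 ^ n := by
    intro n
    induction n with
    | zero => simpa [f] using (hg η x hη0 hx).2
    | succ n ih => exact (hg _ (f n) (hδ (n + 1)) ((ih.trans_le (hδ1 n)).trans hη1)).2
  have hdist : ∀ n, dist (f n) (f (n + 1)) ≤ 4 * η / 2 / 2 ^ n := by
    intro n
    rw [dist_eq_norm]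
    have h1 := (hg _ (f n) (hδ (n + 1)) (((hf n).trans_le (hδ1 n)).trans hη1)).1
    have h2 := hf n
    have h3 : η / 2 ^ (n + 1) ≤ η / 2 ^ n := by
      rw [pow_succ, ← div_div]
      exact half_le_self (hδ n).le
    have h4 : 4 * η / 2 / 2 ^ n = η / 2 ^ n + η / 2 ^ n := by ring
    rw [h4]
    exact h1.le.trans (add_le_add h2.le h3)
  obtain ⟨y, hy⟩ := cauchySeq_tendsto_of_complete (cauchySeq_of_le_geometric_two hdist)
  refine ⟨y, ?_, ?_⟩
  · refine le_antisymm ?_ (M.dN_nonneg y)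
    have h0 : Tendsto (fun n : ℕ => η / 2 ^ n) atTop (𝓝 0) :=
      tendsto_const_nhds.div_atTop (tendsto_pow_atTop_atTop_of_one_lt one_lt_two)
    exact le_of_tendsto_of_tendsto' ((M.continuous_dN.tendsto y).comp hy) h0 fun n => (hf n).le
  · have h1 := dist_le_of_le_geometric_two_of_tendsto₀ hdist hy
    have h2 : ‖x - f 0‖ < M.dN x + η := (hg η x hη0 hx).1
    rw [dist_eq_norm] at h1
    have := norm_sub_le_norm_sub_add_norm_sub x (f 0) y
    linarith

/-- Criterion used for both amalgams and chain limits: `hJ` prevents distances from growing, `h`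
from shrinking. As `Metric.infDist` to the empty set is 0, `hB` is needed for the lower bound. -/
theorem dN_ofSet_eq_of_forall {M : LNStructure.{u}} (hM : Models M T0black) {H : Type u}
    [NormedAddCommGroup H] [InnerProductSpace ℝ H] [CompleteSpace H] {B : Set H} (hB : (0 : H) ∈ B)
    (J : M →ₗᵢ[ℝ] H) (hJ : ∀ z : M, M.dN z = 0 → J z ∈ B)
    (h : ∀ x : M, ∀ y ∈ B, M.dN x ≤ ‖J x - y‖) (x : M) :
    (LNStructure.ofSet H B).dN (J x) = M.dN x := by
  change min 1 (Metric.infDist (J x) B) = M.dN x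
  refine le_antisymm ?_ (le_min (M.dN_le_one x) ?_)
  · rcases (M.dN_le_one x).lt_or_eq with hlt | heq
    · refine le_of_forall_pos_lt_add fun ε hε => (min_le_right _ _).trans_lt ?_
      obtain ⟨y, hy, hxy⟩ := exists_dN_eq_zero_of_models hM hlt hε
      refine (Metric.infDist_le_dist_of_mem (hJ y hy)).trans_lt ?_
      rwa [dist_eq_norm, ← map_sub, J.norm_map]
    · exact heq ▸ min_le_left _ _
  · refine (Metric.le_infDist ⟨0, hB⟩).2 fun {y} hy => ?_
    rw [dist_eq_norm]
    exact h x y hy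

/-! ## Embeddings and quantifier-free formulas -/

/-- The identity embedding. -/
def LNEmbedding.refl (M : LNStructure.{u}) : LNEmbedding M M := ⟨.id, fun _ => rfl⟩

/-- The composition of embeddings. -/
def LNEmbedding.comp {M N K : LNStructure.{u}} (e' : LNEmbedding N K) (e : LNEmbedding M N) :
    LNEmbedding M K :=
  ⟨e'.toMap.comp e.toMap, fun x => (e'.map_dN _).trans (e.map_dN x)⟩

theorem LNEmbedding.isElementary_refl (M : LNStructure.{u}) :
    (LNEmbedding.refl M).IsElementary := fun _ _ _ => rfl

theorem LNEmbedding.term_eval {M N : LNStructure.{u}} (e : LNEmbedding M N) {n : ℕ} (t : Term n)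
    (v : Fin n → M) : t.eval N (fun i => e.toMap (v i)) = e.toMap (t.eval M v) := by
  induction t with
  | var i => rfl
  | zero => exact (map_zero e.toMap).symm
  | add s t hs ht => simp only [Term.eval, hs, ht, map_add]
  | smul r t ht => simp only [Term.eval, ht, map_smul]

theorem LNEmbedding.eval_of_isQF {M N : LNStructure.{u}} (e : LNEmbedding M N) {n : ℕ}
    (φ : Formula n) (hφ : φ.IsQF) (v : Fin n → M) :
    φ.eval N (fun i => e.toMap (v i)) = φ.eval M v := by
  induction φ with
  | dist s t => simp only [Formula.eval, e.term_eval, ← map_sub, e.toMap.norm_map]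
  | inner s t => simp only [Formula.eval, e.term_eval, e.toMap.inner_map_map]
  | dN t => simp only [Formula.eval, e.term_eval, e.map_dN]
  | conn w φ ih =>
    simp only [Formula.eval]
    exact congrArg w (funext fun i => ih i (hφ i) v)
  | sup R φ ih => exact hφ.elim
  | inf R φ ih => exact hφ.elim

theorem LNEmbedding.eval_append_of_isQF {M N : LNStructure.{u}} (e : LNEmbedding M N) {p q : ℕ}
    (φ : Formula (p + q)) (hφ : φ.IsQF) (a : Fin p → M) (v : Fin q → M) :
    φ.eval N (Fin.append (fun i => e.toMap (a i)) fun i => e.toMap (v i)) =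
      φ.eval M (Fin.append a v) := by
  rw [← e.eval_of_isQF φ hφ]
  congr 1
  funext i
  refine Fin.addCases (fun i => ?_) (fun i => ?_) i <;> simp

theorem Term.exists_bound_uniformContinuous (M : LNStructure.{u}) {n : ℕ} (t : Term n) (R : ℝ) :
    UniformContinuous (t.eval M) ∧ ∃ C, ∀ v ∈ Metric.closedBall (0 : Fin n → M) R,
      ‖t.eval M v‖ ≤ C := by
  induction t with
  | var i =>
    exact ⟨Pi.uniformContinuous_proj _ i, R, fun v hv =>
      (norm_le_pi_norm v i).trans (by simpa using hv)⟩
  | zero => exact ⟨uniformContinuous_const, 0, fun v _ => by simp [Term.eval]⟩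
  | add s t hs ht =>
    obtain ⟨hs, C, hC⟩ := hs
    obtain ⟨ht, D, hD⟩ := ht
    exact ⟨hs.add ht, C + D, fun v hv => norm_add_le_of_le (hC v hv) (hD v hv)⟩
  | smul r t ht =>
    obtain ⟨ht, D, hD⟩ := ht
    exact ⟨ht.const_smul r, ‖r‖ * D, fun v hv => by
      simpa [Term.eval, norm_smul] using mul_le_mul_of_nonneg_left (hD v hv) (abs_nonneg r)⟩

/-- A connective is merely continuous; it is uniformly continuous on the compact box containing its
arguments. Boundedness is carried along for the induction on formulas. -/
theorem uniformContinuousOn_comp_of_bound {X : Type*} [UniformSpace X] {s : Set X} {m : ℕ}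
    (w : C(Fin m → ℝ, ℝ)) (g : Fin m → X → ℝ)
    (hg : ∀ i, UniformContinuousOn (g i) s ∧ ∃ C, ∀ x ∈ s, ‖g i x‖ ≤ C) :
    UniformContinuousOn (fun x => w fun i => g i x) s ∧
      ∃ C, ∀ x ∈ s, ‖w fun i => g i x‖ ≤ C := by
  choose hu C hC using hg
  have hK : IsCompact (Set.univ.pi fun i => Metric.closedBall (0 : ℝ) (C i)) :=
    isCompact_univ_pi fun i => isCompact_closedBall _ _
  have hmem : Set.MapsTo (fun x i => g i x) s
      (Set.univ.pi fun i => Metric.closedBall (0 : ℝ) (C i)) := fun x hx i _ => by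
    simpa using hC i x hx
  constructor
  · refine (hK.uniformContinuousOn_of_continuous w.continuous.continuousOn).comp ?_ hmem
    rw [uniformContinuousOn_iff_restrict, uniformContinuous_pi]
    exact fun i => uniformContinuousOn_iff_restrict.1 (hu i)
  · obtain ⟨D, hD⟩ := hK.exists_bound_of_continuousOn w.continuous.continuousOn
    exact ⟨D, fun x hx => hD _ (hmem hx)⟩

theorem Formula.uniformContinuousOn_of_isQF (M : LNStructure.{u}) {n : ℕ} (φ : Formula n)
    (hφ : φ.IsQF) (R : ℝ) :
    UniformContinuousOn (φ.eval M) (Metric.closedBall 0 R) ∧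
      ∃ C, ∀ v ∈ Metric.closedBall (0 : Fin n → M) R, ‖φ.eval M v‖ ≤ C := by
  have hnorm : ∀ {n : ℕ} (t : Term n),
      UniformContinuousOn (fun v => ‖t.eval M v‖) (Metric.closedBall 0 R) ∧
        ∃ C, ∀ v ∈ Metric.closedBall (0 : Fin n → M) R, ‖‖t.eval M v‖‖ ≤ C := fun t => by
    obtain ⟨h, C, hC⟩ := t.exists_bound_uniformContinuous M R
    exact ⟨(uniformContinuous_norm.comp h).uniformContinuousOn, C, fun v hv => by
      rw [norm_norm]; exact hC v hv⟩
  have hsub : ∀ {n : ℕ} (s t : Term n) (v : Fin n → M),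
      (Term.add s (.smul (-1) t)).eval M v = s.eval M v - t.eval M v := fun s t v => by
    simp [Term.eval, sub_eq_add_neg]
  induction φ with
  | dist s t =>
    have h := hnorm (Term.add s (.smul (-1) t))
    simp only [hsub] at h
    exact h
  | inner s t =>
    -- Polarization turns the inner product into a connective applied to three norms.
    have h := uniformContinuousOn_comp_of_bound (s := Metric.closedBall (0 : Fin _ → M) R)
      ⟨fun w : Fin 3 → ℝ => (w 0 * w 0 + w 1 * w 1 - w 2 * w 2) / 2, by fun_prop⟩
      ![fun v => ‖s.eval M v‖, fun v => ‖t.eval M v‖,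
        fun v => ‖(Term.add s (.smul (-1) t)).eval M v‖]
      (by
        intro i
        fin_cases i
        · exact hnorm s
        · exact hnorm t
        · exact hnorm (Term.add s (.smul (-1) t)))
    have he : (Formula.inner s t).eval M = fun v => (‖s.eval M v‖ * ‖s.eval M v‖ +
        ‖t.eval M v‖ * ‖t.eval M v‖ - ‖(Term.add s (.smul (-1) t)).eval M v‖ *
        ‖(Term.add s (.smul (-1) t)).eval M v‖) / 2 := by
      funext v
      rw [hsub]
      exact real_inner_eq_norm_mul_self_add_norm_mul_self_sub_norm_sub_mul_self_div_two _ _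
    rw [he]
    exact h
  | dN t =>
    refine ⟨UniformContinuous.uniformContinuousOn ?_, 1, fun v _ => ?_⟩
    · have hd : UniformContinuous M.dN := (LipschitzWith.of_dist_le_mul (K := 1) fun x y => by
        simpa [Real.dist_eq, dist_eq_norm] using M.dN_modulus x y).uniformContinuous
      exact hd.comp (t.exists_bound_uniformContinuous M R).1
    · exact (abs_of_nonneg (M.dN_nonneg _)).trans_le (M.dN_le_one _)
  | conn w φ ih => exact uniformContinuousOn_comp_of_bound w _ fun i => ih i (hφ i)
  | sup R φ ih => exact hφ.elim
  | inf R φ ih => exact hφ.elim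

end HilbertBlack

namespace HilbertBlack

open Filter Topology

/-! ## Free amalgamation -/

section Adjoint

variable {E F : Type*} [NormedAddCommGroup E] [InnerProductSpace ℝ E] [CompleteSpace E]
  [NormedAddCommGroup F] [InnerProductSpace ℝ F] [CompleteSpace F] (e : E →ₗᵢ[ℝ] F)

/-- The adjoint of a linear isometry: the orthogonal projection onto its domain. -/
noncomputable def adj : F →L[ℝ] E := ContinuousLinearMap.adjoint e.toContinuousLinearMap

theorem inner_adj_right (x : E) (y : F) : inner ℝ x (adj e y) = inner ℝ (e x) y :=
  ContinuousLinearMap.adjoint_inner_right _ _ _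

theorem adj_apply_self (x : E) : adj e (e x) = x :=
  ext_inner_left ℝ fun z => by rw [inner_adj_right, e.inner_map_map]

theorem norm_sq_eq_adj (y : F) : ‖y‖ ^ 2 = ‖adj e y‖ ^ 2 + ‖y - e (adj e y)‖ ^ 2 := by
  have h : inner ℝ (e (adj e y)) (y - e (adj e y)) = 0 := by
    rw [← inner_adj_right, map_sub, adj_apply_self, sub_self, inner_zero_right]
  have := norm_add_sq_eq_norm_sq_add_norm_sq_of_inner_eq_zero _ _ h
  rw [add_sub_cancel, e.norm_map] at this
  simpa [pow_two] using this

theorem norm_sub_sq_eq_adj (x : E) (y : F) :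
    ‖e x - y‖ ^ 2 = ‖x - adj e y‖ ^ 2 + ‖y - e (adj e y)‖ ^ 2 := by
  rw [norm_sq_eq_adj e (e x - y), map_sub, adj_apply_self, map_sub,
    show e x - y - (e x - e (adj e y)) = -(y - e (adj e y)) by abel, norm_neg]

end Adjoint

/-! ### Orthogonal sum of Hilbert spaces over a common subspace -/

section Amalgam

variable {ι : Type u} [DecidableEq ι] {M : Type u} {F : ι → Type u}
  [NormedAddCommGroup M] [InnerProductSpace ℝ M] [CompleteSpace M]
  [∀ i, NormedAddCommGroup (F i)] [∀ i, InnerProductSpace ℝ (F i)] [∀ i, CompleteSpace (F i)]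

/-- The map of `F i` into the orthogonal amalgam of the spaces `F i` over `M`. -/
noncomputable def amalgamMap (e : ∀ i, M →ₗᵢ[ℝ] F i) (i : ι) :
    F i →ₗᵢ[ℝ] WithLp 2 (M × lp F 2) where
  toLinearMap := (WithLp.linearEquiv 2 ℝ (M × lp F 2)).symm.toLinearMap ∘ₗ
    LinearMap.prod (adj (e i)).toLinearMap
      (lp.lsingle (𝕜 := ℝ) 2 i ∘ₗ (LinearMap.id - (e i).toLinearMap ∘ₗ (adj (e i)).toLinearMap))
  norm_map' x := by
    rw [← sq_eq_sq₀ (norm_nonneg _) (norm_nonneg _), WithLp.prod_norm_sq_eq_of_L2,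
      norm_sq_eq_adj (e i) x]
    congr 2
    exact lp.norm_single (by norm_num) _ _

theorem amalgamMap_fst (e : ∀ i, M →ₗᵢ[ℝ] F i) (i : ι) (x : F i) :
    (amalgamMap e i x).fst = adj (e i) x := rfl

theorem amalgamMap_snd (e : ∀ i, M →ₗᵢ[ℝ] F i) (i : ι) (x : F i) :
    (amalgamMap e i x).snd = lp.single 2 i (x - e i (adj (e i) x)) := rfl

theorem amalgamMap_comp (e : ∀ i, M →ₗᵢ[ℝ] F i) (i : ι) (x : M) :
    amalgamMap e i (e i x) = WithLp.toLp 2 (x, 0) := by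
  have h : (amalgamMap e i (e i x)).snd = 0 := by
    rw [amalgamMap_snd, adj_apply_self, sub_self, lp.single_zero]
  have h' : (amalgamMap e i (e i x)).fst = x := by
    rw [amalgamMap_fst, adj_apply_self]
  apply (WithLp.linearEquiv 2 ℝ (M × lp F 2)).injective
  exact Prod.ext h' h

/-- The components orthogonal to `M` lie in different summands, so they are orthogonal to each
other. -/
theorem norm_amalgamMap_sub_sq (e : ∀ i, M →ₗᵢ[ℝ] F i) {i k : ι} (hik : i ≠ k) (x : F i) (y : F k) :
    ‖amalgamMap e i x - amalgamMap e k y‖ ^ 2 = ‖adj (e i) x - adj (e k) y‖ ^ 2 +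
      (‖x - e i (adj (e i) x)‖ ^ 2 + ‖y - e k (adj (e k) y)‖ ^ 2) := by
  rw [WithLp.prod_norm_sq_eq_of_L2, WithLp.sub_fst, WithLp.sub_snd, amalgamMap_fst, amalgamMap_fst,
    amalgamMap_snd, amalgamMap_snd]
  congr 1
  have h : inner ℝ (lp.single 2 i (x - e i (adj (e i) x)) : lp F 2)
      (lp.single 2 k (y - e k (adj (e k) y))) = (0 : ℝ) := by
    rw [lp.inner_single_left, lp.single_apply_ne _ _ _ hik, inner_zero_right]
  rw [norm_sub_sq_real, h, lp.norm_single (by norm_num), lp.norm_single (by norm_num)]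
  ring

end Amalgam

/-- Zeros of `dN` in `M` nearly attain its value at the projection of `x` and remain zeros in `N`;
Pythagoras gives their distance to `x`. If the value at the projection is 1, truncation suffices. -/
theorem dN_sq_le_of_adj {M N : LNStructure.{u}} (hM : Models M T0black) (e : LNEmbedding M N)
    (x : N) : N.dN x ^ 2 ≤ M.dN (adj e.toMap x) ^ 2 + ‖x - e.toMap (adj e.toMap x)‖ ^ 2 := by
  rcases (M.dN_le_one (adj e.toMap x)).lt_or_eq with hlt | heq
  · have hlim : Tendsto (fun ε : ℝ => (M.dN (adj e.toMap x) + ε) ^ 2 +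
        ‖x - e.toMap (adj e.toMap x)‖ ^ 2) (𝓝[>] 0) (𝓝 ((M.dN (adj e.toMap x) + 0) ^ 2 +
        ‖x - e.toMap (adj e.toMap x)‖ ^ 2)) :=
      ((by fun_prop : Continuous fun ε : ℝ => (M.dN (adj e.toMap x) + ε) ^ 2 +
        ‖x - e.toMap (adj e.toMap x)‖ ^ 2).tendsto 0).mono_left nhdsWithin_le_nhds
    rw [add_zero] at hlim
    refine ge_of_tendsto hlim (eventually_mem_nhdsWithin.mono fun ε hε => ?_)
    obtain ⟨y, hy, hxy⟩ := exists_dN_eq_zero_of_models hM hlt hε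
    have h1 : N.dN x ≤ ‖e.toMap y - x‖ := by
      simpa [e.map_dN, hy, norm_sub_rev] using N.dN_le_add x (e.toMap y)
    refine (pow_le_pow_left₀ (N.dN_nonneg x) h1 2).trans ?_
    rw [norm_sub_sq_eq_adj, norm_sub_rev]
    gcongr
  · rw [heq]
    nlinarith [N.dN_le_one x, N.dN_nonneg x, sq_nonneg ‖x - e.toMap (adj e.toMap x)‖]

/-! ### Amalgam of models -/

section

variable {M : LNStructure.{u}} {ι : Type u} [DecidableEq ι] {N : ι → LNStructure.{u}}

/-- The distinguished set of the amalgam: the union of the distinguished sets of the factors. -/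
def amalgamSet (e : ∀ i, LNEmbedding M (N i)) : Set (WithLp 2 (M × lp (fun i => N i) 2)) :=
  {y | ∃ i z, (N i).dN z = 0 ∧ amalgamMap (fun i => (e i).toMap) i z = y}

theorem zero_mem_amalgamSet [Nonempty ι] (hN : ∀ i, Models (N i) T0black)
    (e : ∀ i, LNEmbedding M (N i)) : 0 ∈ amalgamSet e :=
  ⟨Classical.arbitrary ι, 0, dN_zero_of_models (hN _), map_zero _⟩

/-- For a zero z in another factor, write P for the projections to `M`. The squared distance is ‖Px
- Pz‖² + ‖z - Pz‖² + ‖x - Px‖². The first two terms sum to ‖Px - z‖², which is at least the square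
of `dN` at Px; `dN_sq_le_of_adj` concludes. -/
theorem dN_le_norm_amalgamMap_sub (hM : Models M T0black) (e : ∀ i, LNEmbedding M (N i)) (i : ι)
    (x : N i) (y : WithLp 2 (M × lp (fun i => N i) 2)) (hy : y ∈ amalgamSet e) :
    (N i).dN x ≤ ‖amalgamMap (fun i => (e i).toMap) i x - y‖ := by
  obtain ⟨k, z, hz, rfl⟩ := hy
  by_cases hik : i = k
  · subst hik
    rw [← map_sub, LinearIsometry.norm_map]
    simpa [hz] using (N i).dN_le_add x z
  · rw [← sq_le_sq₀ ((N i).dN_nonneg x) (norm_nonneg _)]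
    refine (dN_sq_le_of_adj hM (e i) x).trans ?_
    rw [norm_amalgamMap_sub_sq _ hik]
    have h1 : M.dN (adj (e i).toMap x) ^ 2 ≤ ‖(e k).toMap (adj (e i).toMap x) - z‖ ^ 2 := by
      refine pow_le_pow_left₀ (M.dN_nonneg _) ?_ 2
      rw [← (e k).map_dN]
      simpa [hz] using (N k).dN_le_add ((e k).toMap (adj (e i).toMap x)) z
    rw [norm_sub_sq_eq_adj] at h1
    linarith

/-- The embedding of a factor into the amalgam. -/
noncomputable def amalgamEmbedding [Nonempty ι] (hM : Models M T0black)
    (hN : ∀ i, Models (N i) T0black) (e : ∀ i, LNEmbedding M (N i)) (i : ι) :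
    LNEmbedding (N i) (LNStructure.ofSet (WithLp 2 (M × lp (fun i => N i) 2)) (amalgamSet e)) where
  toMap := amalgamMap (fun i => (e i).toMap) i
  map_dN := dN_ofSet_eq_of_forall (hN i) (zero_mem_amalgamSet hN e) _ (fun z hz => ⟨i, z, hz, rfl⟩)
    (dN_le_norm_amalgamMap_sub hM e i)

end

/-- Any family of models extending `M` embeds into a common model over `M`. -/
theorem exists_amalgam {M : LNStructure.{u}} (hM : Models M T0black) {ι : Type u} [Nonempty ι]
    (N : ι → LNStructure.{u}) (hN : ∀ i, Models (N i) T0black) (e : ∀ i, LNEmbedding M (N i)) :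
    ∃ (A : LNStructure.{u}) (j : LNEmbedding M A) (J : ∀ i, LNEmbedding (N i) A),
      Models A T0black ∧ ∀ i x, (J i).toMap ((e i).toMap x) = j.toMap x := by
  classical
  refine ⟨_, (amalgamEmbedding hM hN e (Classical.arbitrary ι)).comp (e _),
    amalgamEmbedding hM hN e, models_ofSet (zero_mem_amalgamSet hN e), fun i x => ?_⟩
  exact (amalgamMap_comp (fun i => (e i).toMap) i x).trans
    (amalgamMap_comp (fun i => (e i).toMap) _ x).symm

/-- Every model `M` extends to a model in which all quantifier-free conditions over `M` that are
realized in some extension of `M` are realized. -/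
theorem exists_extension_realizing {M : LNStructure.{u}} (hM : Models M T0black) :
    ∃ (A : LNStructure.{u}) (j : LNEmbedding M A), Models A T0black ∧
      ∀ (N : LNStructure.{u}) (e : LNEmbedding M N), Models N T0black →
        ∀ (p q : ℕ) (ψ : Formula (p + q)), ψ.IsQF →
          ∀ (r : Fin p → ℕ+) (b : Fin p → N) (v : Fin q → M), (∀ l, ‖b l‖ ≤ (r l : ℕ)) →
            ψ.eval N (Fin.append b fun i => e.toMap (v i)) = 0 →
              ∃ a : Fin p → A, (∀ l, ‖a l‖ ≤ (r l : ℕ)) ∧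
                ψ.eval A (Fin.append a fun i => j.toMap (v i)) = 0 := by
  -- Indexing by conditions rather than by extensions keeps the family in universe u; one realizing
  -- extension per condition is enough.
  let ι : Type u := Σ p q : ℕ, Formula (p + q) × (Fin p → ℕ+) × (Fin q → M)
  have : Nonempty ι := ⟨⟨0, 0, .dN .zero, Fin.elim0, Fin.elim0⟩⟩
  let P : ι → ∀ N : LNStructure.{u}, LNEmbedding M N → Prop := fun i N e =>
    ∃ b : Fin i.1 → N, (∀ l, ‖b l‖ ≤ (i.2.2.2.1 l : ℕ)) ∧
      i.2.2.1.eval N (Fin.append b fun l => e.toMap (i.2.2.2.2 l)) = 0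
  have hP : ∀ i : ι, ∃ (N : LNStructure.{u}) (e : LNEmbedding M N), Models N T0black ∧
      ∀ (N' : LNStructure.{u}) (e' : LNEmbedding M N'), Models N' T0black → P i N' e' → P i N e := by
    intro i
    by_cases h : ∃ (N : LNStructure.{u}) (e : LNEmbedding M N), Models N T0black ∧ P i N e
    · obtain ⟨N, e, hN, hPe⟩ := h
      exact ⟨N, e, hN, fun _ _ _ _ => hPe⟩
    · exact ⟨M, .refl M, hM, fun N' e' hN' hP' => absurd ⟨N', e', hN', hP'⟩ h⟩
  choose N e hN hmax using hP
  obtain ⟨A, j, J, hA, hJ⟩ := exists_amalgam hM N hN e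
  refine ⟨A, j, hA, fun N' e' hN' p q ψ hψ r b v hb h0 => ?_⟩
  obtain ⟨a, ha, ha0⟩ := hmax ⟨p, q, ψ, r, v⟩ N' e' hN' ⟨b, hb, h0⟩
  refine ⟨fun l => (J _).toMap (a l), fun l => ((J _).toMap.norm_map _).trans_le (ha l), ?_⟩
  rw [← ha0, ← (J ⟨p, q, ψ, r, v⟩).eval_append_of_isQF ψ hψ]
  simp only [hJ]

end HilbertBlack

namespace HilbertBlack

open Filter Topology

/-! ## Limits of chains -/

section Chain

variable {H : ℕ → Type u} [∀ n, NormedAddCommGroup (H n)] [∀ n, InnerProductSpace ℝ (H n)]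
  [∀ n, CompleteSpace (H n)]

/-- The map of `H n` into the `ℓ²`-sum of the chain, by recursion on `n`. -/
noncomputable def chainMapAux (j : ∀ n, H n →ₗᵢ[ℝ] H (n + 1)) : ∀ n, H n →ₗ[ℝ] lp H 2
  | 0 => lp.lsingle (𝕜 := ℝ) 2 0
  | n + 1 => chainMapAux j n ∘ₗ (adj (j n)).toLinearMap +
      lp.lsingle (𝕜 := ℝ) 2 (n + 1) ∘ₗ
        (LinearMap.id - (j n).toLinearMap ∘ₗ (adj (j n)).toLinearMap)

theorem chainMapAux_succ (j : ∀ n, H n →ₗᵢ[ℝ] H (n + 1)) (n : ℕ) (x : H (n + 1)) :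
    chainMapAux j (n + 1) x = chainMapAux j n (adj (j n) x) +
      lp.single 2 (n + 1) (x - j n (adj (j n) x)) := rfl

theorem chainMapAux_apply_of_lt (j : ∀ n, H n →ₗᵢ[ℝ] H (n + 1)) (n : ℕ) (x : H n) {k : ℕ}
    (hk : n < k) : chainMapAux j n x k = 0 := by
  induction n with
  | zero => exact lp.single_apply_ne 2 0 x hk.ne'
  | succ n ih =>
    rw [chainMapAux_succ, lp.coeFn_add, Pi.add_apply, ih _ (by omega),
      lp.single_apply_ne 2 _ _ hk.ne', add_zero]

theorem norm_chainMapAux (j : ∀ n, H n →ₗᵢ[ℝ] H (n + 1)) (n : ℕ) (x : H n) :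
    ‖chainMapAux j n x‖ = ‖x‖ := by
  induction n with
  | zero => exact lp.norm_single (by norm_num) _ _
  | succ n ih =>
    have h : inner ℝ (chainMapAux j n (adj (j n) x))
        (lp.single 2 (n + 1) (x - j n (adj (j n) x)) : lp H 2) = 0 := by
      rw [lp.inner_single_right, chainMapAux_apply_of_lt j n _ n.lt_succ_self, inner_zero_left]
    rw [← sq_eq_sq₀ (norm_nonneg _) (norm_nonneg _), chainMapAux_succ, norm_add_sq_real, h, ih,
      lp.norm_single (by norm_num), norm_sq_eq_adj (j n) x]
    ring

/-- The map of `H n` into the `ℓ²`-sum of the chain. -/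
noncomputable def chainMap (j : ∀ n, H n →ₗᵢ[ℝ] H (n + 1)) (n : ℕ) : H n →ₗᵢ[ℝ] lp H 2 :=
  ⟨chainMapAux j n, norm_chainMapAux j n⟩

theorem chainMap_comp (j : ∀ n, H n →ₗᵢ[ℝ] H (n + 1)) (n : ℕ) (x : H n) :
    chainMap j (n + 1) (j n x) = chainMap j n x := by
  change chainMapAux j (n + 1) (j n x) = chainMapAux j n x
  rw [chainMapAux_succ, adj_apply_self, sub_self, lp.single_zero, add_zero]

/-- A chain of Hilbert spaces has a limit, in which the union of the chain is dense. -/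
theorem exists_chain_limit (j : ∀ n, H n →ₗᵢ[ℝ] H (n + 1)) :
    ∃ (L : Type u) (_ : NormedAddCommGroup L) (_ : InnerProductSpace ℝ L) (_ : CompleteSpace L)
      (J : ∀ n, H n →ₗᵢ[ℝ] L), (∀ n x, J (n + 1) (j n x) = J n x) ∧
        ∀ (x : L) (ε : ℝ), 0 < ε → ∃ n y, ‖J n y - x‖ < ε := by
  let S : ℕ → Submodule ℝ (lp H 2) := fun n => LinearMap.range (chainMap j n).toLinearMap
  have hS : Monotone S := monotone_nat_of_le_succ fun n => by
    rintro _ ⟨x, rfl⟩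
    exact ⟨j n x, chainMap_comp j n x⟩
  let K := (⨆ n, S n).topologicalClosure
  have hmem : ∀ n x, chainMap j n x ∈ K := fun n x =>
    Submodule.le_topologicalClosure _ (Submodule.mem_iSup_of_mem n ⟨x, rfl⟩)
  have hK : CompleteSpace K := (Submodule.isClosed_topologicalClosure _).completeSpace_coe
  refine ⟨K, inferInstance, inferInstance, hK, fun n =>
    ⟨(chainMap j n).toLinearMap.codRestrict K (hmem n), fun x => (chainMap j n).norm_map x⟩,
    fun n x => Subtype.ext (chainMap_comp j n x), fun x ε hε => ?_⟩
  obtain ⟨y, hy, hxy⟩ := Metric.mem_closure_iff.1 x.2 ε hε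
  obtain ⟨n, z, rfl⟩ := (Submodule.mem_iSup_of_directed S hS.directed_le).1 hy
  refine ⟨n, z, ?_⟩
  rw [dist_comm, dist_eq_norm] at hxy
  exact hxy

end Chain

/-- A chain of models has a limit, in which the union of the chain is dense. -/
theorem exists_model_limit (M : ℕ → LNStructure.{u}) (hM : ∀ n, Models (M n) T0black)
    (j : ∀ n, LNEmbedding (M n) (M (n + 1))) :
    ∃ (L : LNStructure.{u}) (J : ∀ n, LNEmbedding (M n) L), Models L T0black ∧
      (∀ n x, (J (n + 1)).toMap ((j n).toMap x) = (J n).toMap x) ∧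
        ∀ (x : L) (ε : ℝ), 0 < ε → ∃ n y, ‖(J n).toMap y - x‖ < ε := by
  obtain ⟨L, _, _, _, J, hJ, hd⟩ := exists_chain_limit fun n => (j n).toMap
  let B : Set L := {y | ∃ n z, (M n).dN z = 0 ∧ J n z = y}
  have hB : 0 ∈ B := ⟨0, 0, dN_zero_of_models (hM 0), map_zero _⟩
  have hlift : ∀ n k, n ≤ k → ∀ x : M n, ∃ y : M k, (M k).dN y = (M n).dN x ∧ J k y = J n x := by
    intro n k hnk x
    induction k, hnk using Nat.le_induction with
    | base => exact ⟨x, rfl, rfl⟩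
    | succ k _ ih =>
      obtain ⟨y, h1, h2⟩ := ih
      exact ⟨(j k).toMap y, ((j k).map_dN y).trans h1, (hJ k y).trans h2⟩
  -- Both points are lifted to a common stage, where the Lipschitz bound applies.
  have hle : ∀ n (x : M n), ∀ y ∈ B, (M n).dN x ≤ ‖J n x - y‖ := by
    rintro n x _ ⟨m, z, hz, rfl⟩
    obtain ⟨x', hx1, hx2⟩ := hlift n (max n m) (le_max_left _ _) x
    obtain ⟨z', hz1, hz2⟩ := hlift m (max n m) (le_max_right _ _) z
    rw [← hx1, ← hx2, ← hz2, ← map_sub, LinearIsometry.norm_map]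
    simpa [hz1, hz] using (M (max n m)).dN_le_add x' z'
  let J' : ∀ n, LNEmbedding (M n) (LNStructure.ofSet L B) := fun n =>
    ⟨J n, dN_ofSet_eq_of_forall (hM n) hB (J n) (fun z hz => ⟨n, z, hz, rfl⟩) (hle n)⟩
  exact ⟨LNStructure.ofSet L B, J', models_ofSet hB, hJ, hd⟩

/-- Every model of `T_0 ∪ {d_N(0) = 0}` has an existentially closed extension. -/
theorem exists_isExistentiallyClosed {M : LNStructure.{u}} (hM : Models M T0black) :
    ∃ (U : LNStructure.{u}) (_ : LNEmbedding M U), IsExistentiallyClosed T0black U := by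
  choose F j hF hreal using fun M : {M : LNStructure.{u} // Models M T0black} =>
    exists_extension_realizing M.2
  let C : ℕ → {M : LNStructure.{u} // Models M T0black} := fun n =>
    Nat.rec ⟨M, hM⟩ (fun _ K => ⟨F K, hF K⟩) n
  obtain ⟨U, J, hU, hJ, hd⟩ := exists_model_limit (fun n => (C n).1) (fun n => (C n).2)
    fun n => j (C n)
  refine ⟨U, J 0, hU, fun N e hN p q ψ hψ r b v hb h0 ε hε => ?_⟩
  have hmono : Monotone fun n => LinearMap.range (J n).toMap.toLinearMap :=
    monotone_nat_of_le_succ fun n => by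
      rintro _ ⟨x, rfl⟩
      exact ⟨(j (C n)).toMap x, hJ n x⟩
  have happrox : ∀ δ : ℝ, 0 < δ → ∃ (n : ℕ) (w : Fin q → (C n).1),
      ∀ i, ‖(J n).toMap (w i) - v i‖ < δ := by
    intro δ hδ
    choose m y hy using fun i => hd (v i) δ hδ
    have : ∀ i, ∃ w : (C (Finset.univ.sup m)).1, (J _).toMap w = (J (m i)).toMap (y i) := fun i =>
      hmono (Finset.le_sup (Finset.mem_univ i)) ⟨y i, rfl⟩
    choose w hw using this
    exact ⟨_, w, fun i => (hw i).symm ▸ hy i⟩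
  obtain ⟨R, hR0, hrR, hvR⟩ : ∃ R : ℝ, 0 ≤ R ∧ (∀ l, ((r l : ℕ) : ℝ) ≤ R) ∧ ∀ i, ‖v i‖ + 1 ≤ R := by
    -- The extra 1 leaves room for approximations of `v` within distance 1.
    refine ⟨‖fun l => ((r l : ℕ) : ℝ)‖ + (‖v‖ + 1), by positivity, fun l => ?_, fun i => ?_⟩
    · have := (le_abs_self _).trans (norm_le_pi_norm (fun l => ((r l : ℕ) : ℝ)) l)
      have := norm_nonneg v
      linarith
    · have := norm_le_pi_norm v i
      have := norm_nonneg fun l => ((r l : ℕ) : ℝ)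
      linarith
  have huc : ∀ K : LNStructure.{u}, ∃ δ : ℝ, 0 < δ ∧ ∀ (a : Fin p → K) (u u' : Fin q → K),
      (∀ l, ‖a l‖ ≤ (r l : ℕ)) → (∀ i, ‖u i‖ ≤ R) → (∀ i, ‖u' i‖ ≤ R) → (∀ i, ‖u i - u' i‖ < δ) →
        |ψ.eval K (Fin.append a u) - ψ.eval K (Fin.append a u')| < ε / 2 := by
    intro K
    obtain ⟨δ, hδ, h⟩ := Metric.uniformContinuousOn_iff.1
      (ψ.uniformContinuousOn_of_isQF K hψ R).1 (ε / 2) (half_pos hε)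
    refine ⟨δ, hδ, fun a u u' ha hu hu' huu => ?_⟩
    have hball : ∀ u : Fin q → K, (∀ i, ‖u i‖ ≤ R) → Fin.append a u ∈ Metric.closedBall 0 R := by
      intro u hu
      rw [mem_closedBall_zero_iff, pi_norm_le_iff_of_nonneg hR0]
      refine Fin.addCases (fun l => ?_) (fun l => ?_)
      · simpa using (ha l).trans (hrR l)
      · simpa using hu l
    have := h _ (hball u hu) _ (hball u' hu') ((dist_pi_lt_iff hδ).2 (Fin.addCases
      (fun l => by simpa using hδ) (fun l => by simpa [dist_eq_norm] using huu l)))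
    rwa [Real.dist_eq] at this
  obtain ⟨δ₁, hδ₁, h1⟩ := huc N
  obtain ⟨δ₂, hδ₂, h2⟩ := huc U
  obtain ⟨n, w, hw⟩ := happrox (min 1 (min δ₁ δ₂)) (by positivity)
  have hwR : ∀ i, ‖(J n).toMap (w i)‖ ≤ R := fun i => by
    have h3 := (hw i).trans_le (min_le_left _ _)
    have h4 := norm_add_le ((J n).toMap (w i) - v i) (v i)
    rw [sub_add_cancel] at h4
    linarith [hvR i]
  have hvR' : ∀ i, ‖v i‖ ≤ R := fun i => by linarith [hvR i]
  have hsmall := h1 b (fun i => e.toMap (v i)) (fun i => e.toMap ((J n).toMap (w i))) hb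
    (fun i => by rw [e.toMap.norm_map]; exact hvR' i)
    (fun i => by rw [e.toMap.norm_map]; exact hwR i)
    (fun i => by
      rw [← map_sub, e.toMap.norm_map, norm_sub_rev]
      exact (hw i).trans_le ((min_le_right _ _).trans (min_le_left _ _)))
  rw [h0, zero_sub, abs_neg] at hsmall
  -- Moving the parameters to stage n costs less than ε/2 in `N`, so the relaxed condition |ψ| ≤ ε/2
  -- is realized exactly at stage n + 1. Returning to `v` inside `U` costs less than another ε/2.
  let ψ' : Formula (p + q) :=
    .conn (m := 1) ⟨fun z => max (|z 0| - ε / 2) 0, by fun_prop⟩ fun _ => ψ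
  obtain ⟨a, ha, ha0⟩ := hreal (C n) N (e.comp (J n)) hN p q ψ' (fun _ => hψ) r b w hb
    (max_eq_right (sub_nonpos.2 hsmall.le))
  have ha1 : |ψ.eval (F (C n)) (Fin.append a fun i => (j (C n)).toMap (w i))| ≤ ε / 2 := by
    have := max_eq_right_iff.1 ha0
    linarith
  have hJa : ∀ l, ‖(J (n + 1)).toMap (a l)‖ ≤ (r l : ℕ) := fun l =>
    ((J (n + 1)).toMap.norm_map (a l)).trans_le (ha l)
  rw [← (J (n + 1)).eval_append_of_isQF ψ hψ] at ha1
  refine ⟨fun l => (J (n + 1)).toMap (a l), hJa, ?_⟩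
  have h3 := h2 (fun l => (J (n + 1)).toMap (a l)) v (fun i => (J n).toMap (w i)) hJa hvR' hwR
    (fun i => by
      rw [norm_sub_rev]
      exact (hw i).trans_le ((min_le_right _ _).trans (min_le_right _ _)))
  have h4 : (fun i => (J (n + 1)).toMap ((j (C n)).toMap (w i))) = fun i => (J n).toMap (w i) :=
    funext fun i => hJ n (w i)
  rw [h4] at ha1
  rw [abs_lt] at h3 ⊢
  rw [abs_le] at ha1
  constructor <;> linarith [ha1.1, ha1.2, h3.1, h3.2]

end HilbertBlack

namespace HilbertBlack

/-! ## The configuration -/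

theorem models_TN_of_isExistentiallyClosed {M : LNStructure.{u}}
    (hM : IsExistentiallyClosed T0black M) : Models M TN.{u} := fun _ hσ => hσ M hM

theorem zero_mem_blackSet {H : Type u} [NormedAddCommGroup H] [InnerProductSpace ℝ H]
    (s : Idx → H) : 0 ∈ blackSet s := Or.inr rfl

theorem blackSet_comp {H K : Type u} [NormedAddCommGroup H] [InnerProductSpace ℝ H]
    [NormedAddCommGroup K] [InnerProductSpace ℝ K] (J : H →ₗᵢ[ℝ] K) (s : Idx → H) :
    blackSet (fun i => J (s i)) = J '' blackSet s := by
  ext x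
  constructor
  · rintro (⟨f, n, rfl⟩ | rfl)
    · exact ⟨_, Or.inl ⟨f, n, rfl⟩, by simp only [map_add, map_smul]⟩
    · exact ⟨0, zero_mem_blackSet s, map_zero J⟩
  · rintro ⟨_, ⟨f, n, rfl⟩ | rfl, rfl⟩
    · exact Or.inl ⟨f, n, by simp only [map_add, map_smul]⟩
    · exact Or.inr (map_zero J)

/-- The range of `J` is closed, so it contains the closed span, and isometries preserve
`Metric.infDist`. -/
theorem dN_eq_of_mem_closure_span {H : Type u} [NormedAddCommGroup H] [InnerProductSpace ℝ H]
    [CompleteSpace H] (s : Idx → H) {U : LNStructure.{u}}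
    (J : H →ₗᵢ[ℝ] U)
    (hJ : ∀ x, U.dN (J x) = min 1 (Metric.infDist x (blackSet s))) {x : U}
    (hx : x ∈ (Submodule.span ℝ (Set.range fun i => J (s i))).topologicalClosure) :
    U.dN x = min 1 (Metric.infDist x (blackSet fun i => J (s i))) := by
  have hK : IsClosed (LinearMap.range J.toLinearMap : Set U) :=
    J.isometry.isClosedEmbedding.isClosed_range
  have hle : (Submodule.span ℝ (Set.range fun i => J (s i))).topologicalClosure ≤
      LinearMap.range J.toLinearMap :=
    Submodule.topologicalClosure_minimal _
      (Submodule.span_le.2 (by rintro _ ⟨i, rfl⟩; exact ⟨s i, rfl⟩)) hK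
  obtain ⟨y, rfl⟩ := hle hx
  refine (hJ y).trans ?_
  rw [blackSet_comp]
  exact congrArg (min 1) (Metric.infDist_image J.isometry).symm

theorem tp2Formula_eval (M : LNStructure.{u}) (x : Fin 1 → M) (y : Fin 2 → M) :
    tp2Formula.eval M (Fin.append x y) =
      max (1 - M.dN (x 0 + y 0 + (-(1 / 2) : ℝ) • y 1)) (M.dN (x 0 + y 0 + (1 / 2 : ℝ) • y 1)) :=
  rfl

section Distances

variable {H : Type u} [NormedAddCommGroup H] [InnerProductSpace ℝ H] {s : Idx → H}

/-- One coefficient of absolute value 1 suffices: at c_{i,f(i)} if `y` has the same f and i, at b_i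
if only the index differs, and at a_f otherwise. -/
theorem one_le_norm_sub_of_mem_blackSet (hs : Orthonormal ℝ s) (f : ℕ → ℕ) (i : ℕ) {y : H}
    (hy : y ∈ blackSet s) :
    1 ≤ ‖s (.a f) + s (.b i) + (-(1 / 2) : ℝ) • s (.c i (f i)) - y‖ := by
  classical
  have hin := orthonormal_iff_ite.1 hs
  have key : ∀ (k : Idx) (v : H), 1 ≤ |inner ℝ (s k) v| → 1 ≤ ‖v‖ := fun k v h => by
    have := abs_real_inner_le_norm (s k) v
    rw [hs.1 k, one_mul] at this
    exact h.trans this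
  rcases hy with ⟨g, n, rfl⟩ | rfl
  · by_cases hg : f = g
    · subst hg
      by_cases hn : i = n
      · subst hn
        refine key (.c i (f i)) _ ?_
        simp only [inner_sub_right, inner_add_right, inner_smul_right, hin]
        norm_num
      · refine key (.b i) _ ?_
        simp [inner_sub_right, inner_add_right, inner_smul_right, hin, hn, hs.1]
    · refine key (.a f) _ ?_
      simp [inner_sub_right, inner_add_right, inner_smul_right, hin, hg, hs.1]
  · refine key (.a f) _ ?_
    simp [inner_add_right, inner_smul_right, hin, hs.1]

theorem norm_half_smul_add_lt_one (hs : Orthonormal ℝ s) {k l : Idx} (hkl : k ≠ l) :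
    ‖(1 / 2 : ℝ) • s k + (1 / 2 : ℝ) • s l‖ < 1 := by
  have h : inner ℝ ((1 / 2 : ℝ) • s k) ((1 / 2 : ℝ) • s l) = 0 := by
    rw [inner_smul_left, inner_smul_right, hs.2 hkl]
    simp
  rw [← sq_lt_one_iff₀ (norm_nonneg _), norm_add_sq_real, h, norm_smul, norm_smul, hs.1, hs.1]
  norm_num

end Distances

/-- The Lipschitz bound excludes a solution in every extension, elementary or not. -/
theorem not_consistent_tp2Formula {U : LNStructure.{u}} {s : Idx → U} (hs : Orthonormal ℝ s)
    (r : Fin 1 → ℕ+) (i : ℕ) {t : Finset ℕ} (ht : t.card = 2) :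
    ¬ Consistent U tp2Formula r ((fun j => ![s (.b i), s (.c i j)]) '' (t : Set ℕ)) := by
  rintro ⟨N, e, -, x, -, h⟩
  obtain ⟨j, k, hjk, rfl⟩ := Finset.card_eq_two.1 ht
  have hj := h _ ⟨j, by simp, rfl⟩
  have hk := h _ ⟨k, by simp, rfl⟩
  rw [tp2Formula_eval] at hj hk
  have h1 : N.dN (x 0 + e.toMap (s (.b i)) + (1 / 2 : ℝ) • e.toMap (s (.c i j))) ≤ 0 :=
    (le_max_right _ _).trans hj.le
  have h2 : 1 - N.dN (x 0 + e.toMap (s (.b i)) + (-(1 / 2) : ℝ) • e.toMap (s (.c i k))) ≤ 0 :=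
    (le_max_left _ _).trans hk.le
  have h3 := N.dN_le_add (x 0 + e.toMap (s (.b i)) + (-(1 / 2) : ℝ) • e.toMap (s (.c i k)))
    (x 0 + e.toMap (s (.b i)) + (1 / 2 : ℝ) • e.toMap (s (.c i j)))
  have h4 := norm_half_smul_add_lt_one (hs.comp_linearIsometry e.toMap)
    (show Idx.c i k ≠ Idx.c i j by simpa using hjk.symm)
  have h5 : x 0 + e.toMap (s (.b i)) + (-(1 / 2) : ℝ) • e.toMap (s (.c i k)) -
      (x 0 + e.toMap (s (.b i)) + (1 / 2 : ℝ) • e.toMap (s (.c i j))) =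
      -((1 / 2 : ℝ) • e.toMap (s (.c i k)) + (1 / 2 : ℝ) • e.toMap (s (.c i j))) := by module
  rw [h5, norm_neg] at h3
  simp only [Function.comp_apply] at h4
  linarith

/-- The path is realized in `U` itself, by a_f. -/
theorem consistent_tp2Formula {U : LNStructure.{u}} {s : Idx → U} (hs : Orthonormal ℝ s)
    (hd : ∀ x ∈ (Submodule.span ℝ (Set.range s)).topologicalClosure,
      U.dN x = min 1 (Metric.infDist x (blackSet s))) (f : ℕ → ℕ) :
    Consistent U tp2Formula (fun _ => 1) (Set.range fun i => ![s (.b i), s (.c i (f i))]) := by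
  refine ⟨U, .refl U, LNEmbedding.isElementary_refl U, fun _ => s (.a f), fun _ => ?_, ?_⟩
  · simp [hs.1]
  rintro _ ⟨i, rfl⟩
  have hmem : ∀ c : ℝ, s (.a f) + s (.b i) + c • s (.c i (f i)) ∈
      (Submodule.span ℝ (Set.range s)).topologicalClosure := fun c =>
    have hsp : ∀ k, s k ∈ Submodule.span ℝ (Set.range s) := fun k => Submodule.subset_span ⟨k, rfl⟩
    Submodule.le_topologicalClosure _
      (add_mem (add_mem (hsp _) (hsp _)) (Submodule.smul_mem _ c (hsp _)))
  rw [tp2Formula_eval]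
  change max (1 - U.dN (s (.a f) + s (.b i) + (-(1 / 2) : ℝ) • s (.c i (f i))))
    (U.dN (s (.a f) + s (.b i) + (1 / 2 : ℝ) • s (.c i (f i)))) = 0
  have h1 : 1 ≤ Metric.infDist (s (.a f) + s (.b i) + (-(1 / 2) : ℝ) • s (.c i (f i)))
      (blackSet s) := by
    refine (Metric.le_infDist ⟨0, zero_mem_blackSet s⟩).2 fun {y} hy => ?_
    rw [dist_eq_norm]
    exact one_le_norm_sub_of_mem_blackSet hs f i hy
  have h2 : Metric.infDist (s (.a f) + s (.b i) + (1 / 2 : ℝ) • s (.c i (f i))) (blackSet s) = 0 :=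
    Metric.infDist_zero_of_mem (Or.inl ⟨f, i, rfl⟩)
  rw [hd _ (hmem _), hd _ (hmem _), h2, min_eq_left h1]
  norm_num

theorem isTP2Array_tp2Formula {U : LNStructure.{u}} {s : Idx → U} (hs : Orthonormal ℝ s)
    (hd : ∀ x ∈ (Submodule.span ℝ (Set.range s)).topologicalClosure,
      U.dN x = min 1 (Metric.infDist x (blackSet s))) :
    IsTP2Array U tp2Formula (fun _ => 1) (fun _ => 1) 2 (fun i j => ![s (.b i), s (.c i j)]) := by
  refine ⟨fun i j l => ?_, fun i t ht => not_consistent_tp2Formula hs _ i ht,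
    consistent_tp2Formula hs hd⟩
  fin_cases l <;> simp [hs.1]

theorem exists_orthonormal_idx : ∃ (H : Type u) (_ : NormedAddCommGroup H)
    (_ : InnerProductSpace ℝ H) (_ : CompleteSpace H) (s : Idx → H), Orthonormal ℝ s := by
  classical
  -- `ULift` places the ℓ² space in universe u.
  refine ⟨lp (fun _ : ULift.{u} Idx => ℝ) 2, inferInstance, inferInstance, inferInstance,
    fun i => lp.single 2 ⟨i⟩ 1, orthonormal_iff_ite.2 fun i j => ?_⟩
  rw [lp.inner_single_left, lp.single_apply]
  by_cases h : i = j
  · subst h; simp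
  · have : (ULift.up i : ULift.{u} Idx) ≠ ⟨j⟩ := fun h' => h (congrArg ULift.down h')
    simp [h, this]

end HilbertBlack

open HilbertBlack in
theorem mainTheorem3 :
    HasTP2.{u} TN.{u} ∧
    ∃ (U : LNStructure.{u}) (s : Idx → U),
      Models U TN.{u} ∧
      Orthonormal ℝ s ∧
      (∀ x ∈ (Submodule.span ℝ (Set.range s)).topologicalClosure,
        U.dN x = min 1 (Metric.infDist x (blackSet s))) ∧
      IsTP2Array U tp2Formula (fun _ => 1) (fun _ => 1) 2
        (fun i j => ![s (.b i), s (.c i j)]) := by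
  obtain ⟨H, _, _, _, s, hs⟩ := exists_orthonormal_idx.{u}
  obtain ⟨U, J, hU, hJ⟩ : ∃ (U : LNStructure.{u}) (J : H →ₗᵢ[ℝ] U),
      IsExistentiallyClosed T0black U ∧
        ∀ x, U.dN (J x) = min 1 (Metric.infDist x (blackSet s)) := by
    obtain ⟨U, J, hU⟩ := exists_isExistentiallyClosed (models_ofSet (zero_mem_blackSet s))
    exact ⟨U, J.toMap, hU, J.map_dN⟩
  have hJs : Orthonormal ℝ fun i => J (s i) := hs.comp_linearIsometry J
  have hd := fun x hx => dN_eq_of_mem_closure_span s J hJ (x := x) hx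
  have hTN := models_TN_of_isExistentiallyClosed hU
  have hTP2 := isTP2Array_tp2Formula hJs hd
  exact ⟨⟨1, 2, tp2Formula, _, _, 2, U, _, hTN, hTP2⟩, U, _, hTN, hJs, hd, hTP2⟩
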